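/- Let $M$ be a complete metric space with a base point $0\in M$. Let $\mathrm{Lip}_0(M)$ be the real Banach space of all Lipschitz functions $f:M\to\mathbb{R}$ with $f(0)=0$, with the norm $\sup\{(f(x)-f(y))/d(x,y) : x\neq y\in M\}$ (and norm $0$ if $M$ is a single point), and let the Lipschitz-free space $\mathcal{F}(M)$ be the norm-closed linear span of the evaluation functionals $\delta(x):f\mapsto f(x)$, $x\in M$, in the dual space $\mathrm{Lip}_0(M)^*$. Let $X$ be a real Banach space that contains no complemented copy of $\ell_1$, that is, no linear subspace of $X$ is both linearly homeomorphic to $\ell_1$ and the range of a bounded linear projection of $X$. If $\mathcal{F}(M)$ contains an isomorphic copy of $X$, that is, a linear subspace linearly homeomorphic to $X$, then there exists a compact set $K\subset M$ with $0\in K$ such that $\mathcal{F}(K)$, the Lipschitz-free space of the metric space $K$ with base point $0$, contains an isomorphic copy of $X$. -/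

import Mathlib

noncomputable section

/-- The real vector space of Lipschitz functions `f : M → ℝ` vanishing at the base point `p`. -/
def lipZeroSubmodule (M : Type*) [MetricSpace M] (p : M) : Submodule ℝ (M → ℝ) where
  carrier := {f | f p = 0 ∧ ∃ C : NNReal, LipschitzWith C f}
  zero_mem' := ⟨rfl, 0, LipschitzWith.const' 0⟩
  add_mem' := by
    rintro f g ⟨hf, C, hC⟩ ⟨hg, D, hD⟩
    exact ⟨by simp [hf, hg], C + D, hC.add hD⟩
  smul_mem' := by
    rintro a f ⟨hf, C, hC⟩
    refine ⟨by simp [hf], ‖a‖₊ * C, LipschitzWith.of_dist_le_mul fun x y => ?_⟩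
    have h := hC.dist_le_mul x y
    simp only [Pi.smul_apply, smul_eq_mul, Real.dist_eq, ← mul_sub, abs_mul, NNReal.coe_mul,
      coe_nnnorm, Real.norm_eq_abs] at h ⊢
    rw [mul_assoc]
    gcongr

/-- The space `Lip₀(M)` of the pointed metric space `(M, p)`. It is a type of its own (not the
subtype) so that its only topology is the one of the Lipschitz norm below. -/
def LipZero (M : Type*) [MetricSpace M] (p : M) : Type _ := lipZeroSubmodule M p

namespace LipZero

variable {M : Type*} [MetricSpace M] {p : M}

instance : AddCommGroup (LipZero M p) := inferInstanceAs (AddCommGroup (lipZeroSubmodule M p))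

instance : Module ℝ (LipZero M p) := inferInstanceAs (Module ℝ (lipZeroSubmodule M p))

instance : CoeFun (LipZero M p) (fun _ => M → ℝ) := ⟨fun f => f.1⟩

theorem ext {f g : LipZero M p} (h : ∀ x, f x = g x) : f = g := Subtype.ext (funext h)

@[simp] theorem zero_apply (x : M) : (0 : LipZero M p) x = 0 := rfl

@[simp] theorem add_apply (f g : LipZero M p) (x : M) : (f + g) x = f x + g x := rfl

@[simp] theorem smul_apply (a : ℝ) (f : LipZero M p) (x : M) : (a • f) x = a * f x := rfl

theorem apply_base (f : LipZero M p) : f p = 0 := f.2.1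

/-- The Lipschitz norm `sup {(f x - f y) / d(x, y) : x ≠ y}`; the set is bounded above because `f`
is Lipschitz, and the supremum is `0` when `M` is a single point. -/
instance : Norm (LipZero M p) :=
  ⟨fun f => sSup {r : ℝ | ∃ x y : M, x ≠ y ∧ r = (f x - f y) / dist x y}⟩

theorem norm_def (f : LipZero M p) :
    ‖f‖ = sSup {r : ℝ | ∃ x y : M, x ≠ y ∧ r = (f x - f y) / dist x y} := rfl

theorem bddAbove_slopes (f : LipZero M p) :
    BddAbove {r : ℝ | ∃ x y : M, x ≠ y ∧ r = (f x - f y) / dist x y} := by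
  obtain ⟨C, hC⟩ := f.2.2
  refine ⟨C, ?_⟩
  rintro r ⟨x, y, hxy, rfl⟩
  rw [div_le_iff₀ (dist_pos.2 hxy)]
  exact (le_abs_self _).trans (hC.dist_le_mul x y)

theorem sub_le_norm_mul_dist (f : LipZero M p) (x y : M) : f x - f y ≤ ‖f‖ * dist x y := by
  rcases eq_or_ne x y with rfl | hxy
  · simp
  · rw [← div_le_iff₀ (dist_pos.2 hxy)]
    exact le_csSup f.bddAbove_slopes ⟨x, y, hxy, rfl⟩

theorem abs_sub_le_norm_mul_dist (f : LipZero M p) (x y : M) :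
    |f x - f y| ≤ ‖f‖ * dist x y := by
  refine abs_le.2 ⟨?_, f.sub_le_norm_mul_dist x y⟩
  have h := f.sub_le_norm_mul_dist y x
  rw [dist_comm] at h
  linarith

theorem norm_le_of_forall {f : LipZero M p} {C : ℝ} (hC : 0 ≤ C)
    (h : ∀ x y, f x - f y ≤ C * dist x y) : ‖f‖ ≤ C := by
  refine Real.sSup_le ?_ hC
  rintro r ⟨x, y, hxy, rfl⟩
  rw [div_le_iff₀ (dist_pos.2 hxy)]
  exact h x y

theorem norm_nonneg' (f : LipZero M p) : 0 ≤ ‖f‖ := by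
  by_cases h : ∃ x y : M, x ≠ y
  · obtain ⟨x, y, hxy⟩ := h
    have h1 := (abs_nonneg _).trans (f.abs_sub_le_norm_mul_dist x y)
    exact nonneg_of_mul_nonneg_left h1 (dist_pos.2 hxy)
  · refine Real.sSup_nonneg ?_
    rintro r ⟨x, y, hxy, -⟩
    exact absurd ⟨x, y, hxy⟩ h

theorem norm_smul_le' (a : ℝ) (f : LipZero M p) : ‖a • f‖ ≤ |a| * ‖f‖ := by
  refine norm_le_of_forall (mul_nonneg (abs_nonneg a) f.norm_nonneg') fun x y => ?_
  calc (a • f) x - (a • f) y = a * (f x - f y) := by simp [mul_sub]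
    _ ≤ |a| * |f x - f y| := by rw [← abs_mul]; exact le_abs_self _
    _ ≤ |a| * (‖f‖ * dist x y) := by gcongr; exact f.abs_sub_le_norm_mul_dist x y
    _ = |a| * ‖f‖ * dist x y := by ring

theorem normedSpaceCore : NormedSpace.Core ℝ (LipZero M p) where
  norm_nonneg := norm_nonneg'
  norm_smul a f := by
    refine le_antisymm (norm_smul_le' a f) ?_
    rcases eq_or_ne a 0 with rfl | ha
    · simpa using norm_nonneg' _
    · have h := norm_smul_le' a⁻¹ (a • f)
      rw [inv_smul_smul₀ ha, abs_inv] at h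
      rw [Real.norm_eq_abs]
      calc |a| * ‖f‖ ≤ |a| * (|a|⁻¹ * ‖a • f‖) := by gcongr
        _ = ‖a • f‖ := by rw [← mul_assoc, mul_inv_cancel₀ (abs_ne_zero.2 ha), one_mul]
  norm_triangle f g := by
    refine norm_le_of_forall (add_nonneg f.norm_nonneg' g.norm_nonneg') fun x y => ?_
    have h1 := f.sub_le_norm_mul_dist x y
    have h2 := g.sub_le_norm_mul_dist x y
    simp only [add_apply]
    linarith
  norm_eq_zero_iff f := by
    constructor
    · intro h
      refine ext fun x => ?_
      have h1 := f.abs_sub_le_norm_mul_dist x p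
      rw [h, zero_mul, f.apply_base, sub_zero] at h1
      simpa using h1
    · rintro rfl
      refine le_antisymm (norm_le_of_forall le_rfl fun x y => by simp) (norm_nonneg' _)

instance : NormedAddCommGroup (LipZero M p) := NormedAddCommGroup.ofCore normedSpaceCore

instance : NormedSpace ℝ (LipZero M p) := NormedSpace.ofCore normedSpaceCore

/-- The evaluation functional `δ(x) : f ↦ f x`, an element of the dual of `Lip₀(M)`. -/
def delta (p x : M) : StrongDual ℝ (LipZero M p) :=
  LinearMap.mkContinuous
    { toFun := fun f => f x
      map_add' := fun _ _ => rfl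
      map_smul' := fun _ _ => rfl }
    (dist x p) fun f => by
      have h := f.abs_sub_le_norm_mul_dist x p
      rw [f.apply_base, sub_zero, mul_comm] at h
      exact h

@[simp] theorem delta_apply (x : M) (f : LipZero M p) : delta p x f = f x := rfl

end LipZero

/-- The Lipschitz-free space `F(M)` of the metric space `M` with base point `p`: the norm-closed
linear span of the evaluation functionals in the dual of `Lip₀(M)`. -/
def lipschitzFree (M : Type*) [MetricSpace M] (p : M) :
    Submodule ℝ (StrongDual ℝ (LipZero M p)) :=
  (Submodule.span ℝ (Set.range (LipZero.delta p))).topologicalClosure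

/-- `Y` contains an isomorphic copy of `X`: some linear subspace of `Y` is linearly homeomorphic
to `X`. -/
def ContainsCopy (X Y : Type*) [NormedAddCommGroup X] [NormedSpace ℝ X]
    [NormedAddCommGroup Y] [NormedSpace ℝ Y] : Prop :=
  ∃ Z : Submodule ℝ Y, Nonempty (X ≃L[ℝ] Z)

/-- `Y` contains a complemented copy of `X`: some linear subspace of `Y` is linearly homeomorphic
to `X` and is the range of a bounded linear projection of `Y`. -/
def ContainsComplementedCopy (X Y : Type*) [NormedAddCommGroup X] [NormedSpace ℝ X]
    [NormedAddCommGroup Y] [NormedSpace ℝ Y] : Prop :=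
  ∃ Z : Submodule ℝ Y, Nonempty (X ≃L[ℝ] Z) ∧ Z.ClosedComplemented

end

/-! The embedding of `X` is perturbed, by a small amount in operator norm, to an operator whose
values all live on one compact set; a small perturbation of an embedding is still an embedding.

The absence of a complemented `ℓ¹` gives tightness (`exists_finite_tight`). If the image of the unit
ball were not concentrated near any finite set, a gliding hump would produce `x n` in the unit ball
of `X` and uniformly bounded Lipschitz functions `f n` with disjoint supports and `S (x n) (f n) ≥ ε
/ 2`. Disjointness makes the pulled-back functionals `z ↦ S z (f n)` a weakly unconditionally Cauchy
series in the dual of `X`, and Rosenthal's lemma then lets the identity of `ℓ¹` factor through `X`.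

Localisation is multiplication by a cutoff function. It is bounded on `Lip₀(M)`, uniformly over all
finite sets, provided the neighbourhoods widen in proportion to `1 + d(e, p)`, because `|f x| ≤ ‖f‖
d(x, p)`. Its adjoint preserves `F(M)` and does not enlarge supports, so compressions at scales
tending to zero can be iterated with summable errors. The limit is supported on every set of a
decreasing sequence of closed sets with ever finer finite covers. Since `M` is complete, these sets
shrink to a compact `K`; elements of `F(M)` supported on `K` come isometrically from `F(K)`. -/

/-! ### Combinatorics of infinite matrices -/

/-- A form of **Rosenthal's lemma**: a nonnegative infinite matrix with uniformly bounded column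
sums has an infinite principal submatrix with small off-diagonal column sums. -/
theorem exists_injective_offDiag_sum_le {ε : ℝ} (N : ℕ) (a : ℕ → ℕ → ℝ)
    (ha : ∀ m i, 0 ≤ a m i) (hN : ∀ i (s : Finset ℕ), ∑ m ∈ s, a m i ≤ N * ε) (hε : 0 ≤ ε) :
    ∃ φ : ℕ → ℕ, φ.Injective ∧
      ∀ k (s : Finset ℕ), k ∉ s → ∑ m ∈ s, a (φ m) (φ k) ≤ ε := by
  induction N generalizing a with
  | zero => exact ⟨id, Function.injective_id, fun k s _ => (hN k s).trans (by simpa using hε)⟩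
  | succ N ih =>
    -- The sets `{Nat.pair q k | k}` split `ℕ` into infinitely many infinite blocks. If every block
    -- fails, each supplies one bad column, and the induction continues on the submatrix of these
    -- bad indices.
    by_cases h : ∃ q, ∀ k (s : Finset ℕ), k ∉ s →
        ∑ m ∈ s, a (Nat.pair q m) (Nat.pair q k) ≤ ε
    · obtain ⟨q, hq⟩ := h
      exact ⟨Nat.pair q, fun m n hmn => (Nat.pair_eq_pair.1 hmn).2, hq⟩
    push Not at h
    choose k s hks hsum using h
    have hinj : Function.Injective fun q => Nat.pair q (k q) :=
      fun m n hmn => (Nat.pair_eq_pair.1 hmn).1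
    obtain ⟨φ, hφ, hφs⟩ := ih (fun m i => a (Nat.pair m (k m)) (Nat.pair i (k i)))
      (fun _ _ => ha _ _) (by
        intro i t
        have hdisj : Disjoint (t.image fun q => Nat.pair q (k q)) ((s i).image (Nat.pair i)) := by
          rw [Finset.disjoint_left]
          intro z hz hz'
          obtain ⟨m, -, rfl⟩ := Finset.mem_image.1 hz
          obtain ⟨j, hj, hjm⟩ := Finset.mem_image.1 hz'
          obtain ⟨rfl, rfl⟩ := Nat.pair_eq_pair.1 hjm
          exact hks _ hj
        have h1 := hN (Nat.pair i (k i))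
          -- The witness `s i` of failure avoids all selected indices and already carries more than
          -- `ε` of the column sum, so at most `N * ε` is left for the selected ones.
          ((t.image fun q => Nat.pair q (k q)) ∪ (s i).image (Nat.pair i))
        rw [Finset.sum_union hdisj, Finset.sum_image fun _ _ _ _ h => hinj h,
          Finset.sum_image fun _ _ _ _ h => (Nat.pair_eq_pair.1 h).2] at h1
        have h2 := hsum i
        push_cast at h1
        linarith)
    exact ⟨fun m => Nat.pair (φ m) (k (φ m)), hinj.comp hφ, hφs⟩

/-! ### Complemented copies of `ℓ¹` -/

section LOne

variable {X : Type*} [NormedAddCommGroup X] [NormedSpace ℝ X]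

/-- If the identity of `Y` factors through `X`, then `X` contains a complemented copy of `Y`. -/
theorem containsComplementedCopy_of_leftInverse {Y : Type*} [NormedAddCommGroup Y]
    [NormedSpace ℝ Y] (A : Y →L[ℝ] X) (B : X →L[ℝ] Y) (h : ∀ y, B (A y) = y) :
    ContainsComplementedCopy Y X := by
  refine ⟨A.range, ⟨ContinuousLinearEquiv.equivOfInverse A.rangeRestrict
    (B.comp A.range.subtypeL) (fun y => h y) ?_⟩, (A.rangeRestrict).comp B, ?_⟩
  · rintro ⟨_, y, rfl⟩
    exact Subtype.ext (congrArg A (h y))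
  · rintro ⟨_, y, rfl⟩
    exact Subtype.ext (congrArg A (h y))

theorem lp_one_norm_eq_tsum (a : lp (fun _ : ℕ => ℝ) 1) : ‖a‖ = ∑' k, |a k| := by
  simpa using lp.norm_eq_tsum_rpow (p := 1) (by simp) a

theorem lp_one_summable (a : lp (fun _ : ℕ => ℝ) 1) : Summable fun k => |a k| := by
  simpa using (lp.memℓp a).summable (by simp)

/-- The operator `ℓ¹ → X` mapping the unit vectors to a bounded sequence. -/
theorem exists_lp_one_lift [CompleteSpace X] (x : ℕ → X) (hx : ∀ n, ‖x n‖ ≤ 1) :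
    ∃ A : lp (fun _ : ℕ => ℝ) 1 →L[ℝ] X, ∀ n, A (lp.single 1 n (1 : ℝ)) = x n := by
  have hbound : ∀ (a : lp (fun _ : ℕ => ℝ) 1) k, ‖a k • x k‖ ≤ |a k| := fun a k => by
    rw [norm_smul, Real.norm_eq_abs]
    exact mul_le_of_le_one_right (abs_nonneg _) (hx k)
  have hs : ∀ a : lp (fun _ : ℕ => ℝ) 1, Summable fun k => a k • x k := fun a =>
    Summable.of_norm_bounded (lp_one_summable a) (hbound a)
  refine ⟨LinearMap.mkContinuous
    { toFun := fun a => ∑' k, a k • x k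
      map_add' := fun a b => by
        rw [← (hs a).tsum_add (hs b)]
        exact tsum_congr fun k => add_smul _ _ _
      map_smul' := fun c a => by
        rw [RingHom.id_apply, ← (hs a).tsum_const_smul]
        exact tsum_congr fun k => mul_smul _ _ _ } 1 fun a => ?_, fun n => ?_⟩
  · rw [one_mul, lp_one_norm_eq_tsum]
    exact tsum_of_norm_bounded (lp_one_summable a).hasSum (hbound a)
  · change ∑' k, (lp.single 1 n (1 : ℝ) : lp (fun _ : ℕ => ℝ) 1) k • x k = x n
    rw [tsum_eq_single n fun k hk => by simp [lp.single_apply, hk]]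
    simp [lp.single_apply]

/-- The operator `X → ℓ¹` given by a weakly unconditionally Cauchy series in the dual. -/
theorem exists_toLpOne (y : ℕ → StrongDual ℝ X) {C : ℝ}
    (hy : ∀ x (s : Finset ℕ), ∑ n ∈ s, |y n x| ≤ C * ‖x‖) :
    ∃ B : X →L[ℝ] lp (fun _ : ℕ => ℝ) 1, ∀ x n, B x n = y n x := by
  have hs : ∀ x, Summable fun n => |y n x| := fun x =>
    summable_of_sum_le (fun _ => abs_nonneg _) (hy x)
  have hmem : ∀ x, Memℓp (fun n => y n x) 1 := fun x => by
    refine memℓp_gen ?_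
    simpa using hs x
  refine ⟨LinearMap.mkContinuous
    { toFun := fun x => (⟨fun n => y n x, hmem x⟩ : lp (fun _ : ℕ => ℝ) 1)
      map_add' := fun a b => by ext n; exact map_add (y n) a b
      map_smul' := fun c a => by ext n; exact map_smul (y n) c a } C fun x => ?_, fun x n => rfl⟩
  rw [lp_one_norm_eq_tsum]
  exact (hs x).tsum_le_of_sum_le (hy x)

theorem lp_one_opNorm_le {Y : Type*} [NormedAddCommGroup Y] [NormedSpace ℝ Y]
    (T : lp (fun _ : ℕ => ℝ) 1 →L[ℝ] Y) {c : ℝ} (hc : 0 ≤ c)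
    (h : ∀ n, ‖T (lp.single 1 n (1 : ℝ))‖ ≤ c) : ‖T‖ ≤ c := by
  refine T.opNorm_le_bound hc fun a => ?_
  have h1 : HasSum (fun n => T (lp.single 1 n (a n))) (T a) :=
    (lp.hasSum_single (by simp) a).mapL T
  have h2 : ∀ n, ‖T (lp.single 1 n (a n))‖ ≤ c * |a n| := fun n => by
    have h3 : (lp.single 1 n (a n) : lp (fun _ : ℕ => ℝ) 1) = a n • lp.single 1 n (1 : ℝ) := by
      rw [← lp.single_smul, smul_eq_mul, mul_one]
    rw [h3, map_smul, norm_smul, Real.norm_eq_abs, mul_comm]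
    exact mul_le_mul_of_nonneg_right (h n) (abs_nonneg _)
  rw [← h1.tsum_eq, lp_one_norm_eq_tsum]
  exact tsum_of_norm_bounded ((lp_one_summable a).hasSum.mul_left c) h2

/-- **Bessaga–Pełczyński**: a weakly unconditionally Cauchy series in the dual of `X` whose terms
do not tend to zero uniformly on the unit ball yields a complemented copy of `ℓ¹` in `X`. -/
theorem containsComplementedCopy_lp_one [CompleteSpace X] (x : ℕ → X) (hx : ∀ n, ‖x n‖ ≤ 1)
    (y : ℕ → StrongDual ℝ X) {C ε : ℝ} (hε : 0 < ε)
    (hy : ∀ x (s : Finset ℕ), ∑ n ∈ s, |y n x| ≤ C * ‖x‖) (hyx : ∀ n, ε ≤ y n (x n)) :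
    ContainsComplementedCopy (lp (fun _ : ℕ => ℝ) 1) X := by
  obtain ⟨N, hN⟩ := exists_nat_ge (C / (ε / 2))
  have hC : 0 ≤ C := by
    have h1 := hy (x 0) {0}
    rw [Finset.sum_singleton] at h1
    have h2 := (hyx 0).trans ((le_abs_self _).trans h1)
    by_contra! h3
    nlinarith [norm_nonneg (x 0)]
  obtain ⟨φ, hφ, hoff⟩ := exists_injective_offDiag_sum_le (ε := ε / 2) N
    (fun m i => |y m (x i)|) (fun _ _ => abs_nonneg _) (fun i s => by
      refine (hy (x i) s).trans ?_
      rw [div_le_iff₀ (by positivity)] at hN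
      exact (mul_le_of_le_one_right hC (hx i)).trans hN) (by positivity)
  have hpos : ∀ n, 0 < y n (x n) := fun n => hε.trans_le (hyx n)
  have hinv : ∀ n, (y n (x n))⁻¹ ≤ ε⁻¹ := fun n => inv_anti₀ hε (hyx n)
  have hscale : ∀ n z, |((y n (x n))⁻¹ • y n) z| ≤ ε⁻¹ * |y n z| := fun n z => by
    rw [_root_.smul_apply, smul_eq_mul, abs_mul, abs_of_pos (inv_pos.2 (hpos n))]
    exact mul_le_mul_of_nonneg_right (hinv n) (abs_nonneg _)
  obtain ⟨A, hA⟩ := exists_lp_one_lift (fun n => x (φ n)) fun n => hx _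
  obtain ⟨B, hB⟩ := exists_toLpOne (C := ε⁻¹ * C)
    (fun n => (y (φ n) (x (φ n)))⁻¹ • y (φ n)) (fun z s => by
      calc _ ≤ ∑ n ∈ s, ε⁻¹ * |y (φ n) z| := Finset.sum_le_sum fun n _ => hscale _ _
        _ = ε⁻¹ * ∑ m ∈ s.image φ, |y m z| := by
          rw [Finset.mul_sum, Finset.sum_image fun _ _ _ _ h => hφ h]
        _ ≤ ε⁻¹ * (C * ‖z‖) := by gcongr; exact hy _ _
        _ = _ := by ring)
  -- The matrix of `B ∘ A` has diagonal `1` after normalisation, and its off-diagonal column sums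
  -- are at most `ε⁻¹ * (ε / 2)`. A Neumann series then inverts it, and `B` is corrected by the
  -- inverse.
  have hnorm : ‖1 - B.comp A‖ ≤ 1 / 2 := by
    refine lp_one_opNorm_le _ (by norm_num) fun k => ?_
    rw [lp_one_norm_eq_tsum]
    refine (lp_one_summable _).tsum_le_of_sum_le fun s => ?_
    have hval : ∀ m, |((1 - B.comp A) (lp.single 1 k (1 : ℝ))) m|
        ≤ if m = k then 0 else ε⁻¹ * |y (φ m) (x (φ k))| := fun m => by
      have h1 : ((1 - B.comp A) (lp.single 1 k (1 : ℝ))) m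
          = (lp.single 1 k (1 : ℝ) : lp (fun _ : ℕ => ℝ) 1) m
            - ((y (φ m) (x (φ m)))⁻¹ • y (φ m)) (x (φ k)) := by
        rw [← hB, ← hA]; rfl
      rw [h1]
      split_ifs with hmk
      · subst hmk
        simp [lp.single_apply, (hpos _).ne']
      · have : (lp.single 1 k (1 : ℝ) : lp (fun _ : ℕ => ℝ) 1) m = 0 := by
          simp [lp.single_apply, hmk]
        rw [this, zero_sub, abs_neg]
        exact hscale _ _
    calc _ ≤ ∑ m ∈ s, if m = k then 0 else ε⁻¹ * |y (φ m) (x (φ k))| :=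
          Finset.sum_le_sum fun m _ => hval m
      _ = ε⁻¹ * ∑ m ∈ s.erase k, |y (φ m) (x (φ k))| := by
          rw [Finset.mul_sum, ← Finset.filter_ne', Finset.sum_filter]
          exact Finset.sum_congr rfl fun m _ => by by_cases h : m = k <;> simp [h]
      _ ≤ ε⁻¹ * (ε / 2) := by gcongr; exact hoff k _ (by simp)
      _ = 1 / 2 := by field_simp
  obtain ⟨U, hU⟩ : IsUnit (B.comp A) := by
    have := isUnit_one_sub_of_norm_lt_one (hnorm.trans_lt (by norm_num))
    rwa [sub_sub_cancel] at this
  let V : lp (fun _ : ℕ => ℝ) 1 →L[ℝ] lp (fun _ : ℕ => ℝ) 1 := U.inv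
  refine containsComplementedCopy_of_leftInverse A (V.comp B) fun a => ?_
  have h1 : V * B.comp A = 1 := by rw [← hU]; exact U.inv_mul
  exact congrArg (fun T : lp (fun _ : ℕ => ℝ) 1 →L[ℝ] lp (fun _ : ℕ => ℝ) 1 => T a) h1

end LOne

/-! ### Lipschitz functions with disjoint supports -/

namespace LipZero

variable {M : Type*} [MetricSpace M] {p : M}

theorem abs_apply_le (f : LipZero M p) (x : M) : |f x| ≤ ‖f‖ * dist x p := by
  simpa [f.apply_base] using f.abs_sub_le_norm_mul_dist x p

@[simp] theorem sub_apply (f g : LipZero M p) (x : M) : (f - g) x = f x - g x := rfl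

theorem sum_apply {ι : Type*} (s : Finset ι) (f : ι → LipZero M p) (x : M) :
    (∑ i ∈ s, f i) x = ∑ i ∈ s, f i x := by
  classical
  induction s using Finset.induction_on with
  | empty => rfl
  | insert i s hi ih => rw [Finset.sum_insert hi, Finset.sum_insert hi, add_apply, ih]

theorem exists_of_slope {g : M → ℝ} {C : ℝ} (hC : 0 ≤ C) (h0 : g p = 0)
    (h : ∀ x y, g x - g y ≤ C * dist x y) :
    ∃ f : LipZero M p, (∀ x, f x = g x) ∧ ‖f‖ ≤ C := by
  have hg : LipschitzWith ⟨C, hC⟩ g := by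
    refine LipschitzWith.of_dist_le_mul fun x y => ?_
    rw [Real.dist_eq]
    refine abs_le.2 ⟨?_, h x y⟩
    have := h y x
    rw [dist_comm] at this
    change -(C * dist x y) ≤ _
    linarith
  exact ⟨⟨g, h0, _, hg⟩, fun _ => rfl, norm_le_of_forall hC h⟩

/-- A signed sum of functions with disjoint supports has at most twice their Lipschitz norm. -/
theorem norm_sum_smul_le_of_disjoint {f : ℕ → LipZero M p} {C : ℝ} (hC : 0 ≤ C)
    (hf : ∀ i, ‖f i‖ ≤ C) (hd : ∀ i j, i ≠ j → ∀ x, f i x = 0 ∨ f j x = 0)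
    (a : ℕ → ℝ) (ha : ∀ i, |a i| ≤ 1) (s : Finset ℕ) :
    ‖∑ i ∈ s, a i • f i‖ ≤ 2 * C := by
  have hval : ∀ x, ∃ i, ∀ j, j ≠ i → f j x = 0 := fun x => by
    by_contra! h
    obtain ⟨j, hj, hjx⟩ := h 0
    obtain ⟨k, hk, hkx⟩ := h j
    rcases hd j k hk.symm x with h | h <;> contradiction
  refine norm_le_of_forall (by positivity) fun x y => ?_
  have hterm : ∀ i, a i * (f i x - f i y) ≤ C * dist x y := fun i => by
    refine (le_abs_self _).trans ?_
    rw [abs_mul]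
    calc _ ≤ 1 * (‖f i‖ * dist x y) :=
          mul_le_mul (ha i) ((f i).abs_sub_le_norm_mul_dist x y) (abs_nonneg _) zero_le_one
      _ ≤ C * dist x y := by rw [one_mul]; gcongr; exact hf i
  obtain ⟨i, hi⟩ := hval x
  obtain ⟨j, hj⟩ := hval y
  simp only [sum_apply, smul_apply]
  calc ∑ k ∈ s, a k * f k x - ∑ k ∈ s, a k * f k y
      = ∑ k ∈ s, a k * (f k x - f k y) := by
        rw [← Finset.sum_sub_distrib]
        exact Finset.sum_congr rfl fun k _ => (mul_sub _ _ _).symm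
    -- Only the index active at `x` and the one active at `y` contribute, whence the factor `2`.
    _ = ∑ k ∈ s with k ∈ ({i, j} : Finset ℕ), a k * (f k x - f k y) := by
        refine (Finset.sum_filter_of_ne fun k _ hk => ?_).symm
        by_contra h
        simp only [Finset.mem_insert, Finset.mem_singleton, not_or] at h
        exact hk (by rw [hi k h.1, hj k h.2, sub_zero, mul_zero])
    _ ≤ (Finset.card {k ∈ s | k ∈ ({i, j} : Finset ℕ)}) • (C * dist x y) :=
        Finset.sum_le_card_nsmul _ _ _ fun k _ => hterm k
    _ ≤ 2 • (C * dist x y) := by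
        refine nsmul_le_nsmul_left (by positivity) ?_
        exact (Finset.card_le_card fun k hk => (Finset.mem_filter.1 hk).2).trans
          Finset.card_le_two
    _ = 2 * C * dist x y := by rw [nsmul_eq_mul]; push_cast; ring

/-- Choosing signs turns the sum of absolute values into the value of `φ` at one signed sum. This is
the weak unconditional Cauchy estimate needed for the `ℓ¹` criterion. -/
theorem sum_abs_le_of_disjoint {f : ℕ → LipZero M p} {C : ℝ} (hC : 0 ≤ C)
    (hf : ∀ i, ‖f i‖ ≤ C) (hd : ∀ i j, i ≠ j → ∀ x, f i x = 0 ∨ f j x = 0)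
    (φ : StrongDual ℝ (LipZero M p)) (s : Finset ℕ) :
    ∑ i ∈ s, |φ (f i)| ≤ 2 * C * ‖φ‖ := by
  have h1 : ∑ i ∈ s, |φ (f i)| = φ (∑ i ∈ s, (SignType.sign (φ (f i)) : ℝ) • f i) := by
    rw [map_sum]
    refine Finset.sum_congr rfl fun i _ => ?_
    rw [map_smul, smul_eq_mul, sign_mul_self]
  rw [h1, mul_comm]
  refine (le_abs_self _).trans ((φ.le_opNorm _).trans ?_)
  gcongr
  refine norm_sum_smul_le_of_disjoint hC hf hd _ (fun i => ?_) s
  rcases SignType.sign (φ (f i)) <;> simp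

/-! ### Weighted neighbourhoods and cutoff operators -/

/-- The neighbourhood of `E` whose width at `e` is `r (1 + d(e, p))`. -/
def nhd (p : M) (E : Set M) (r : ℝ) : Set M :=
  ⋃ e ∈ E, Metric.closedBall e (r * (1 + dist e p))

theorem mem_nhd {E : Set M} {r : ℝ} {x : M} :
    x ∈ nhd p E r ↔ ∃ e ∈ E, dist x e ≤ r * (1 + dist e p) := by
  simp [nhd]

theorem nhd_mono {E F : Set M} (h : E ⊆ F) (r : ℝ) : nhd p E r ⊆ nhd p F r :=
  Set.biUnion_subset_biUnion_left h

theorem subset_nhd (E : Set M) {r : ℝ} (hr : 0 ≤ r) : E ⊆ nhd p E r := fun x hx =>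
  mem_nhd.2 ⟨x, hx, by rw [dist_self]; positivity⟩

theorem isClosed_nhd {E : Set M} (hE : E.Finite) (r : ℝ) : IsClosed (nhd p E r) :=
  hE.isClosed_biUnion fun _ _ => Metric.isClosed_closedBall

/-- Cutoff functions `h` whose slope at `x` is of order at most `1 / d(x, p)`. -/
theorem exists_cutoff (p : M) {E : Set M} (hE : E.Finite) {r : ℝ} (hr : 0 < r) :
    ∃ h : M → ℝ, (∀ x, 0 ≤ h x) ∧ (∀ x, h x ≤ 1) ∧ (∀ x ∈ nhd p E r, h x = 1) ∧
      (∀ x, x ∉ nhd p E (2 * r) → h x = 0) ∧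
      ∀ x y, h y ≤ h x → dist x p * (h x - h y) ≤ (r⁻¹ + 2) * dist x y := by
  induction E, hE using Set.Finite.induction_on with
  | empty =>
    refine ⟨0, by simp, by simp, by simp [nhd], by simp, fun x y _ => ?_⟩
    simp only [Pi.zero_apply, sub_zero, mul_zero]
    positivity
  | @insert e E _ _ ih =>
    obtain ⟨h, h0, h1, hin, hout, hs⟩ := ih
    set R := r * (1 + dist e p) with hR
    have hRpos : 0 < R := by positivity
    let g : M → ℝ := fun x => max 0 (min 1 (2 - dist x e / R))
    have g0 : ∀ x, 0 ≤ g x := fun x => le_max_left _ _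
    have g1 : ∀ x, g x ≤ 1 := fun x => max_le zero_le_one (min_le_left _ _)
    have gin : ∀ x, dist x e ≤ R → g x = 1 := fun x hx => by
      have : dist x e / R ≤ 1 := (div_le_one hRpos).2 hx
      simp only [g]
      rw [min_eq_left (by linarith), max_eq_right zero_le_one]
    have gout : ∀ x, 2 * R ≤ dist x e → g x = 0 := fun x hx => by
      have : 2 ≤ dist x e / R := (le_div_iff₀ hRpos).2 hx
      simp only [g]
      rw [max_eq_left ((min_le_right _ _).trans (by linarith))]
    have gs : ∀ x y, g y ≤ g x → dist x p * (g x - g y) ≤ (r⁻¹ + 2) * dist x y := by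
      intro x y _
      rcases le_total (2 * R) (dist x e) with hx | hx
      · rw [gout x hx]
        have : dist x p * (0 - g y) ≤ 0 :=
          mul_nonpos_of_nonneg_of_nonpos dist_nonneg (by linarith [g0 y])
        exact this.trans (by positivity)
      have hslope : g x - g y ≤ dist x y / R := by
        have hd : dist y e / R ≤ dist x e / R + dist x y / R := by
          rw [← add_div]
          gcongr
          linarith [dist_triangle y x e, dist_comm x y]
        have hnn : 0 ≤ dist x y / R := by positivity
        rw [sub_le_iff_le_add]
        refine max_le (by linarith [g0 y]) ?_
        have h3 : min 1 (2 - dist y e / R) ≤ g y := le_max_right _ _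
        rcases min_choice 1 (2 - dist y e / R) with h4 | h4
        · rw [h4] at h3
          exact (min_le_left _ _).trans (by linarith)
        · rw [h4] at h3
          exact (min_le_right _ _).trans (by linarith)
      -- The radius `R` grows with `dist e p` so that this bound has a constant independent of `e`.
      have hxp : dist x p ≤ (r⁻¹ + 2) * R := by
        have h5 : r⁻¹ * R = 1 + dist e p := by rw [hR]; field_simp
        linarith [dist_triangle x e p]
      calc dist x p * (g x - g y) ≤ dist x p * (dist x y / R) := by gcongr
        _ ≤ (r⁻¹ + 2) * R * (dist x y / R) := by gcongr
        _ = _ := by field_simp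
    -- Bumps are combined by a maximum, not a sum, so the slope constant does not depend on the size
    -- of `E`.
    refine ⟨fun x => max (g x) (h x), fun x => (g0 x).trans (le_max_left _ _),
      fun x => max_le (g1 x) (h1 x), fun x hx => ?_, fun x hx => ?_, fun x y hxy => ?_⟩
    · obtain ⟨e', he', hxe⟩ := mem_nhd.1 hx
      rcases he' with rfl | he'
      · exact le_antisymm (max_le (g1 x) (h1 x)) ((gin x hxe).ge.trans (le_max_left _ _))
      · exact le_antisymm (max_le (g1 x) (h1 x))
          ((hin x (mem_nhd.2 ⟨e', he', hxe⟩)).ge.trans (le_max_right _ _))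
    · have hgx : g x = 0 := gout x <| by
        by_contra! h6
        exact hx (mem_nhd.2 ⟨e, Set.mem_insert _ _, by rw [mul_assoc]; exact h6.le⟩)
      have hhx := hout x fun h6 => hx (nhd_mono (Set.subset_insert _ _) _ h6)
      simp [hgx, hhx]
    · rcases max_choice (g x) (h x) with h7 | h7
      · simp only [h7] at hxy ⊢
        refine le_trans ?_ (gs x y ((le_max_left _ _).trans hxy))
        gcongr
        exact le_max_left _ _
      · simp only [h7] at hxy ⊢
        refine le_trans ?_ (hs x y ((le_max_right _ _).trans hxy))
        gcongr
        exact le_max_right _ _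

/-- Multiplication by a cutoff function is a bounded operator on `Lip₀(M)`. -/
theorem exists_mul_cutoff (p : M) {E : Set M} (hE : E.Finite) {r : ℝ} (hr : 0 < r) :
    ∃ T : LipZero M p →L[ℝ] LipZero M p, ‖T‖ ≤ r⁻¹ + 3 ∧
      (∀ x, ∃ c : ℝ, ∀ f, T f x = c * f x) ∧
      (∀ f, ∀ x ∈ nhd p E r, T f x = f x) ∧ ∀ f, ∀ x, x ∉ nhd p E (2 * r) → T f x = 0 := by
  obtain ⟨h, h0, h1, hin, hout, hs⟩ := exists_cutoff p hE hr
  have key : ∀ f : LipZero M p, ∃ g : LipZero M p, (∀ x, g x = h x * f x) ∧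
      ‖g‖ ≤ (r⁻¹ + 3) * ‖f‖ := fun f => by
    refine exists_of_slope (by positivity) (by simp [f.apply_base]) fun x y => ?_
    have hf := f.abs_sub_le_norm_mul_dist x y
    have main : ∀ u v : M, dist u v = dist x y → h v ≤ h u →
        |f u| * (h u - h v) ≤ (r⁻¹ + 2) * ‖f‖ * dist x y := fun u v huv hvu =>
      calc |f u| * (h u - h v) ≤ ‖f‖ * dist u p * (h u - h v) := 
            mul_le_mul_of_nonneg_right (f.abs_apply_le u) (sub_nonneg.2 hvu)
        _ = ‖f‖ * (dist u p * (h u - h v)) := by ring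
        _ ≤ ‖f‖ * ((r⁻¹ + 2) * dist u v) := mul_le_mul_of_nonneg_left (hs u v hvu) (norm_nonneg f)
        _ = _ := by rw [huv]; ring
    have hsmall : ∀ z, h z * (f x - f y) ≤ ‖f‖ * dist x y := fun z =>
      calc h z * (f x - f y) ≤ h z * |f x - f y| := by gcongr; exacts [h0 z, le_abs_self _]
        _ ≤ 1 * |f x - f y| := by gcongr; exact h1 z
        _ ≤ _ := by rwa [one_mul]
    -- In the product rule, the value of `f` multiplying the increment of `h` is taken at the point
    -- where `h` is larger, since the slope bound on `h` is weighted by the distance of that point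
    -- from `p`.
    rcases le_total (h y) (h x) with hyx | hxy
    · have h2 := main x y rfl hyx
      have h3 := hsmall y
      have h4 : f x * (h x - h y) ≤ |f x| * (h x - h y) := 
        mul_le_mul_of_nonneg_right (le_abs_self _) (sub_nonneg.2 hyx)
      linarith
    · have h2 := main y x (dist_comm _ _) hxy
      have h3 := hsmall x
      have h4 : -f y * (h y - h x) ≤ |f y| * (h y - h x) := 
        mul_le_mul_of_nonneg_right (neg_le_abs _) (sub_nonneg.2 hxy)
      linarith
  choose T hT hTn using key
  refine ⟨LinearMap.mkContinuous
    { toFun := T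
      map_add' := fun f g => ext fun x => by simp only [hT, add_apply]; ring
      map_smul' := fun a f => ext fun x => by simp [hT]; ring } (r⁻¹ + 3) hTn,
    LinearMap.mkContinuous_norm_le _ (by positivity) _, fun x => ⟨h x, fun f => hT f x⟩,
    fun f x hx => ?_, fun f x hx => ?_⟩
  · change T f x = f x
    rw [hT, hin x hx, one_mul]
  · change T f x = 0
    rw [hT, hout x hx, zero_mul]

/-! ### Supports of functionals -/

/-- A functional on `Lip₀(M)` is supported on `A` if it kills the functions vanishing on `A`. -/
def SupportedOn (A : Set M) (φ : StrongDual ℝ (LipZero M p)) : Prop :=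
  ∀ f : LipZero M p, (∀ x ∈ A, f x = 0) → φ f = 0

theorem delta_mem_lipschitzFree (x : M) : delta p x ∈ lipschitzFree M p :=
  Submodule.le_topologicalClosure _ (Submodule.subset_span ⟨x, rfl⟩)

theorem isClosed_lipschitzFree : IsClosed (lipschitzFree M p : Set (StrongDual ℝ (LipZero M p))) :=
  Submodule.isClosed_topologicalClosure _

theorem exists_finite_supportedOn {φ : StrongDual ℝ (LipZero M p)}
    (hφ : φ ∈ Submodule.span ℝ (Set.range (delta p))) :
    ∃ F : Set M, F.Finite ∧ SupportedOn F φ := by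
  induction hφ using Submodule.span_induction with
  | mem φ h =>
    obtain ⟨x, rfl⟩ := h
    exact ⟨{x}, Set.finite_singleton x, fun f hf => hf x rfl⟩
  | zero => exact ⟨∅, Set.finite_empty, fun f _ => rfl⟩
  | add φ ψ _ _ h1 h2 =>
    obtain ⟨F, hF, hφ⟩ := h1
    obtain ⟨G, hG, hψ⟩ := h2
    refine ⟨F ∪ G, hF.union hG, fun f hf => ?_⟩
    rw [_root_.add_apply, hφ f fun x hx => hf x (Or.inl hx), hψ f fun x hx => hf x (Or.inr hx), add_zero]
  | smul a φ _ h =>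
    obtain ⟨F, hF, hφ⟩ := h
    refine ⟨F, hF, fun f hf => ?_⟩
    rw [_root_.smul_apply, hφ f hf, smul_zero]

theorem exists_finite_approx {φ : StrongDual ℝ (LipZero M p)} (hφ : φ ∈ lipschitzFree M p)
    {η : ℝ} (hη : 0 < η) :
    ∃ γ, ‖φ - γ‖ < η ∧ ∃ F : Set M, F.Finite ∧ SupportedOn F γ := by
  obtain ⟨γ, hγ, hd⟩ := Metric.mem_closure_iff.1 (show φ ∈ closure _ from hφ) η hη
  exact ⟨γ, by rwa [← dist_eq_norm], exists_finite_supportedOn hγ⟩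

/-- The adjoint of a multiplication operator maps `F(M)` to itself. -/
theorem comp_mem_lipschitzFree {T : LipZero M p →L[ℝ] LipZero M p}
    (hT : ∀ x, ∃ c : ℝ, ∀ f, T f x = c * f x) {φ : StrongDual ℝ (LipZero M p)}
    (hφ : φ ∈ lipschitzFree M p) : φ.comp T ∈ lipschitzFree M p := by
  let A : StrongDual ℝ (LipZero M p) →L[ℝ] StrongDual ℝ (LipZero M p) :=
    ContinuousLinearMap.precomp ℝ T
  have hA : Submodule.span ℝ (Set.range (delta p)) ≤ (lipschitzFree M p).comap A.toLinearMap := by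
    rw [Submodule.span_le]
    rintro _ ⟨x, rfl⟩
    obtain ⟨c, hc⟩ := hT x
    have : A (delta p x) = c • delta p x := ContinuousLinearMap.ext fun f => hc f
    change A (delta p x) ∈ lipschitzFree M p
    rw [this]
    exact Submodule.smul_mem _ _ (delta_mem_lipschitzFree x)
  exact Submodule.topologicalClosure_minimal _ hA
    (isClosed_lipschitzFree.preimage A.continuous) hφ

/-! ### Tightness and compression -/

section Tight

variable {X : Type*} [NormedAddCommGroup X] [NormedSpace ℝ X] [CompleteSpace X]

/-- The image of the unit ball of a space without complemented copies of `ℓ¹` is tight. -/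
theorem exists_finite_tight (hX : ¬ ContainsComplementedCopy (lp (fun _ : ℕ => ℝ) 1) X)
    (S : X →L[ℝ] StrongDual ℝ (LipZero M p)) (hS : ∀ x, S x ∈ lipschitzFree M p)
    {r ε : ℝ} (hr : 0 < r) (hε : 0 < ε) :
    ∃ E : Set M, E.Finite ∧ ∀ x, ‖x‖ ≤ 1 → ∀ g : LipZero M p, ‖g‖ ≤ 1 →
      (∀ z ∈ nhd p E r, g z = 0) → |S x g| ≤ ε := by
  by_contra! hcon
  set L := (r / 2)⁻¹ + 3 with hL
  have hLpos : 0 < L := by positivity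
  have step : ∀ E : {E : Set M // E.Finite}, ∃ E' : {E : Set M // E.Finite}, ∃ x : X,
      ∃ f : LipZero M p, E.1 ⊆ E'.1 ∧ ‖x‖ ≤ 1 ∧ ‖f‖ ≤ L ∧ (∀ z ∈ nhd p E.1 r, f z = 0) ∧
      (∀ z, z ∉ nhd p E'.1 r → f z = 0) ∧ ε / 2 ≤ S x f := by
    rintro ⟨E, hE⟩
    obtain ⟨x, hx, g, hg, hgE, hSg⟩ := hcon E hE
    wlog hpos : 0 ≤ S x g generalizing x
    · exact this (-x) (by rwa [norm_neg]) (by simpa using hSg) (by simp; linarith)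
    rw [abs_of_nonneg hpos] at hSg
    obtain ⟨γ, hγ, F, hF, hFγ⟩ := exists_finite_approx (hS x)
      (show 0 < ε / 2 / (1 + L) by positivity)
    -- Cutting off at scale `r / 2` confines `T g` to the `r`-neighbourhood of `F`. As `T g = g` on
    -- `F`, the functional `γ` does not see the change, and `S x` loses at most `ε / 2`.
    obtain ⟨T, hT, hmul, hTF, hT0⟩ := exists_mul_cutoff p hF (half_pos hr)
    rw [mul_div_cancel₀ r two_ne_zero] at hT0
    refine ⟨⟨E ∪ F, hE.union hF⟩, x, T g, Set.subset_union_left, hx, ?_, ?_, ?_, ?_⟩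
    · exact (T.le_opNorm g).trans ((mul_le_of_le_one_right (norm_nonneg _) hg).trans hT)
    · intro z hz
      obtain ⟨c, hc⟩ := hmul z
      rw [hc, hgE z hz, mul_zero]
    · exact fun z hz => hT0 g z fun h => hz (nhd_mono Set.subset_union_right r h)
    · have h1 : γ (g - T g) = 0 := hFγ _ fun z hz => by
        rw [sub_apply, hTF g z (subset_nhd F (half_pos hr).le hz), sub_self]
      have h2 : ‖g - T g‖ ≤ 1 + L :=
        (norm_sub_le _ _).trans (add_le_add hg ((T.le_opNorm g).trans
          ((mul_le_of_le_one_right (norm_nonneg _) hg).trans hT)))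
      have h3 : S x (g - T g) ≤ ε / 2 := by
        have h4 : S x (g - T g) = (S x - γ) (g - T g) := by
          rw [_root_.sub_apply, h1, sub_zero]
        rw [h4]
        calc _ ≤ ‖S x - γ‖ * ‖g - T g‖ := (le_abs_self _).trans ((S x - γ).le_opNorm _)
          _ ≤ ε / 2 / (1 + L) * (1 + L) := by gcongr
          _ = ε / 2 := by field_simp
      rw [map_sub] at h3
      linarith
  choose next x f hsub hx hfn hf0 hfs hSf using step
  let E : ℕ → {E : Set M // E.Finite} := fun n => next^[n] ⟨∅, Set.finite_empty⟩
  have hE : ∀ n, E (n + 1) = next (E n) := fun n => Function.iterate_succ_apply' _ _ _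
  have hmono : Monotone fun n => (E n).1 := monotone_nat_of_le_succ fun n => by
    change (E n).1 ⊆ (E (n + 1)).1
    rw [hE]
    exact hsub _
  -- Later functions vanish on the neighbourhood that contains the supports of all earlier ones.
  have hlt : ∀ i j, i < j → ∀ z, f (E i) z = 0 ∨ f (E j) z = 0 := fun i j hij z => by
    by_cases hz : z ∈ nhd p (E j).1 r
    · exact Or.inr (hf0 _ z hz)
    · refine Or.inl (hfs _ z fun h => hz (nhd_mono ?_ r h))
      rw [← hE]
      exact hmono hij
  refine hX (containsComplementedCopy_lp_one (C := 2 * L * ‖S‖) (fun n => x (E n)) (fun n => hx _)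
    (fun n => (ContinuousLinearMap.apply ℝ ℝ (f (E n))).comp S) (half_pos hε)
    (fun z s => ?_) fun n => hSf _)
  refine (sum_abs_le_of_disjoint hLpos.le (fun n => hfn (E n)) (fun i j hij => ?_) (S z) s).trans ?_
  · rcases hij.lt_or_gt with h | h
    · exact hlt i j h
    · exact fun z => (hlt j i h z).symm
  · rw [mul_assoc _ ‖S‖]
    gcongr
    exact S.le_opNorm z

/-- One step of the reduction: compress an operator into `F(M)` to a neighbourhood of a finite
set. -/
theorem exists_compression (hX : ¬ ContainsComplementedCopy (lp (fun _ : ℕ => ℝ) 1) X)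
    (S : X →L[ℝ] StrongDual ℝ (LipZero M p)) (hS : ∀ x, S x ∈ lipschitzFree M p)
    {r ε : ℝ} (hr : 0 < r) (hε : 0 < ε) :
    ∃ (S' : X →L[ℝ] StrongDual ℝ (LipZero M p)) (E : Set M), (∀ x, S' x ∈ lipschitzFree M p) ∧
      E.Finite ∧ p ∈ E ∧ ‖S - S'‖ ≤ ε ∧ ∀ A, (∀ x, SupportedOn A (S x)) →
        ∀ x, SupportedOn (A ∩ nhd p E (2 * r)) (S' x) := by
  set L := r⁻¹ + 3 with hL
  have hLpos : 0 < L := by positivity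
  obtain ⟨E, hE, htight⟩ := exists_finite_tight hX S hS hr (show 0 < ε / (1 + L) by positivity)
  -- Adding `p` keeps the base point in every localising set, hence in the final compact set.
  obtain ⟨T, hT, hmul, hTE, hT0⟩ := exists_mul_cutoff p (hE.insert p) hr
  refine ⟨(ContinuousLinearMap.precomp ℝ T).comp S, insert p E,
    fun x => comp_mem_lipschitzFree hmul (hS x), hE.insert p, Set.mem_insert _ _, ?_, ?_⟩
  · refine ContinuousLinearMap.opNorm_le_of_unit_norm hε.le fun x hx => ?_
    refine ContinuousLinearMap.opNorm_le_of_unit_norm hε.le fun g hg => ?_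
    have hle : ‖g - T g‖ ≤ 1 + L :=
      (norm_sub_le _ _).trans (add_le_add hg.le ((T.le_opNorm g).trans
        ((mul_le_of_le_one_right (norm_nonneg _) hg.le).trans hT)))
    -- The discarded part `g - T g` vanishes near `E`; after rescaling into the unit ball it is
    -- controlled by tightness.
    have h1 := htight x hx.le ((1 + L)⁻¹ • (g - T g)) (by
      rw [norm_smul, Real.norm_of_nonneg (by positivity)]
      exact (inv_mul_le_one₀ (by positivity)).2 hle) fun z hz => by
        rw [smul_apply, sub_apply, hTE g z (nhd_mono (Set.subset_insert _ _) r hz), sub_self,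
          mul_zero]
    rw [map_smul, smul_eq_mul, abs_mul, abs_of_pos (by positivity), le_div_iff₀ (by positivity),
      mul_comm, mul_inv_cancel_left₀ (by positivity), map_sub] at h1
    exact h1
  · intro A hA x f hf
    refine hA x (T f) fun z hz => ?_
    by_cases hzE : z ∈ nhd p (insert p E) (2 * r)
    · obtain ⟨c, hc⟩ := hmul z
      rw [hc, hf z ⟨hz, hzE⟩, mul_zero]
    · exact hT0 f z hzE

end Tight

end LipZero

/-! ### Decreasing sets with vanishing measure of noncompactness -/

/-- **Kuratowski's intersection theorem**: a decreasing sequence of closed sets whose measures of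
noncompactness tend to zero converges to its intersection, which is compact. -/
theorem isCompact_iInter_and_subset_thickening {M : Type*} [MetricSpace M] [CompleteSpace M]
    {C : ℕ → Set M} (hC : ∀ n, IsClosed (C n)) (hanti : Antitone C)
    (hcov : ∀ ε > 0, ∃ n, ∃ E : Set M, E.Finite ∧ C n ⊆ ⋃ e ∈ E, Metric.ball e ε) :
    IsCompact (⋂ n, C n) ∧ ∀ η > 0, ∃ n, C n ⊆ Metric.thickening η (⋂ n, C n) := by
  constructor
  · refine isCompact_iff_totallyBounded_isComplete.2
      ⟨Metric.totallyBounded_iff.2 fun ε hε => ?_, (isClosed_iInter hC).isComplete⟩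
    obtain ⟨n, E, hE, hn⟩ := hcov ε hε
    exact ⟨E, hE, (Set.iInter_subset _ n).trans hn⟩
  intro η hη
  by_contra! hcon
  choose x hx hxK using fun n => Set.not_subset.1 (hcon n)
  let U := Ultrafilter.of (Filter.map x Filter.atTop)
  have hU : (U : Filter M) ≤ Filter.map x Filter.atTop := Ultrafilter.of_le _
  have hCU : ∀ n, C n ∈ U := fun n =>
    hU (Filter.mem_map.2 (Filter.mem_atTop_sets.2 ⟨n, fun m hm => hanti hm (hx m)⟩))
  -- An ultrafilter containing a finite union of small balls contains one of them. Its limit lies in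
  -- every `C n`, although the sequence stays outside the thickening.
  have hcauchy : Cauchy (U : Filter M) := by
    refine Metric.cauchy_iff.2 ⟨U.neBot, fun ε hε => ?_⟩
    obtain ⟨n, E, hE, hn⟩ := hcov (ε / 2) (half_pos hε)
    obtain ⟨e, -, he⟩ := (Ultrafilter.finite_biUnion_mem_iff hE).1
      (Filter.mem_of_superset (hCU n) hn)
    refine ⟨_, he, fun y hy z hz => ?_⟩
    linarith [dist_triangle_right y z e, Metric.mem_ball.1 hy, Metric.mem_ball.1 hz]
  obtain ⟨y, hy⟩ := CompleteSpace.complete hcauchy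
  have hyK : y ∈ ⋂ n, C n := Set.mem_iInter.2 fun n =>
    (hC n).mem_of_frequently_of_tendsto
      (Filter.Eventually.frequently (f := (U : Filter M)) (hCU n)) (f := id) hy
  have h1 : Metric.thickening η (⋂ n, C n) ∈ U :=
    hy (Metric.isOpen_thickening.mem_nhds (Metric.self_subset_thickening hη _ hyK))
  have h2 : (Metric.thickening η (⋂ n, C n))ᶜ ∈ U :=
    hU (Filter.mem_map.2 (Filter.Eventually.of_forall hxK))
  exact Ultrafilter.compl_mem_iff_notMem.1 h2 h1

/-! ### Elements of `F(M)` supported on a subset -/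

namespace LipZero

variable {M : Type*} [MetricSpace M] {p : M}

/-- Elements of `F(M)` are small on bounded families of uniformly small functions. -/
theorem exists_forall_abs_apply_le {φ : StrongDual ℝ (LipZero M p)}
    (hφ : φ ∈ lipschitzFree M p) {C ε : ℝ} (hC : 0 ≤ C) (hε : 0 < ε) :
    ∃ η > 0, ∀ f : LipZero M p, ‖f‖ ≤ C → (∀ x, |f x| ≤ η) → |φ f| ≤ ε := by
  have hspan : ∀ γ ∈ Submodule.span ℝ (Set.range (delta p)), ∃ B, 0 ≤ B ∧
      ∀ (f : LipZero M p) (η : ℝ), (∀ x, |f x| ≤ η) → |γ f| ≤ B * η := fun γ hγ => by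
    induction hγ using Submodule.span_induction with
    | mem γ h =>
      obtain ⟨x, rfl⟩ := h
      exact ⟨1, zero_le_one, fun f η hf => by rw [one_mul]; exact hf x⟩
    | zero => exact ⟨0, le_rfl, fun f η _ => by simp⟩
    | add γ ψ _ _ h1 h2 =>
      obtain ⟨B, hB, h1⟩ := h1
      obtain ⟨D, hD, h2⟩ := h2
      refine ⟨B + D, add_nonneg hB hD, fun f η hf => ?_⟩
      rw [add_mul]
      exact (abs_add_le _ _).trans (add_le_add (h1 f η hf) (h2 f η hf))
    | smul a γ _ h =>
      obtain ⟨B, hB, h⟩ := h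
      refine ⟨|a| * B, by positivity, fun f η hf => ?_⟩
      rw [_root_.smul_apply, smul_eq_mul, abs_mul, mul_assoc]
      exact mul_le_mul_of_nonneg_left (h f η hf) (abs_nonneg a)
  obtain ⟨γ, hγ, hd⟩ := Metric.mem_closure_iff.1 (show φ ∈ closure _ from hφ)
    (ε / 2 / (C + 1)) (by positivity)
  rw [dist_eq_norm] at hd
  obtain ⟨B, hB, hγB⟩ := hspan γ hγ
  refine ⟨ε / 2 / (B + 1), by positivity, fun f hf hη => ?_⟩
  have h1 : |γ f| ≤ ε / 2 := (hγB f _ hη).trans <| by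
    rw [mul_div_assoc', div_le_iff₀ (by positivity)]
    nlinarith
  have h2 : |(φ - γ) f| ≤ ε / 2 := ((φ - γ).le_opNorm f).trans <| by
    calc _ ≤ ε / 2 / (C + 1) * (C + 1) := by gcongr; linarith
      _ = ε / 2 := by field_simp
  have h3 : φ f = (φ - γ) f + γ f := by rw [_root_.sub_apply]; ring
  rw [h3]
  linarith [abs_add_le ((φ - γ) f) (γ f)]

/-- Soft thresholding of a Lipschitz function. -/
theorem exists_soft_threshold (f : LipZero M p) {η : ℝ} (hη : 0 ≤ η) :
    ∃ g : LipZero M p, ‖g‖ ≤ ‖f‖ ∧ (∀ x, |g x| ≤ η) ∧ ∀ x, |f x| ≤ η → g x = f x := by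
  obtain ⟨g, hg, hgn⟩ := exists_of_slope (p := p) (g := fun x => max (-η) (min η (f x)))
    (norm_nonneg f) (by simp [f.apply_base, hη]) fun x y => by
      have h0 := f.sub_le_norm_mul_dist x y
      have h1 : 0 ≤ ‖f‖ * dist x y := by positivity
      rw [sub_le_iff_le_add]
      refine max_le (by linarith [le_max_left (-η) (min η (f y))]) ?_
      have h2 := le_max_right (-η) (min η (f y))
      rcases min_choice η (f y) with h3 | h3 <;> rw [h3] at h2
      · exact (min_le_left _ _).trans (by rw [h3]; linarith)
      · exact (min_le_right _ _).trans (by rw [h3]; linarith)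
  refine ⟨g, hgn, fun x => ?_, fun x hx => ?_⟩
  · rw [hg]
    exact abs_le.2 ⟨le_max_left _ _, max_le (by linarith) (min_le_left _ _)⟩
  · obtain ⟨h1, h2⟩ := abs_le.1 hx
    rw [hg]
    simp only [min_eq_right h2, max_eq_right h1]

/-- A Lipschitz function vanishing on `K` is uniformly small on a thin thickening of `K`, where it
coincides with its truncation at a low level. So `φ` takes the same value on the function and on the
truncation, and the latter value is arbitrarily small. -/
theorem supportedOn_of_thickening {φ : StrongDual ℝ (LipZero M p)} (hφ : φ ∈ lipschitzFree M p)
    {K : Set M} (h : ∀ η > 0, SupportedOn (Metric.thickening η K) φ) : SupportedOn K φ := by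
  intro f hf
  by_contra hne
  obtain ⟨η, hη, hsmall⟩ := exists_forall_abs_apply_le hφ (norm_nonneg f)
    (half_pos (abs_pos.2 hne))
  obtain ⟨g, hgn, hgη, hgf⟩ := exists_soft_threshold f hη.le
  have h1 : φ (f - g) = 0 := by
    refine h (η / (‖f‖ + 1)) (by positivity) _ fun x hx => ?_
    obtain ⟨k, hk, hxk⟩ := Metric.mem_thickening_iff.1 hx
    have h2 := f.abs_sub_le_norm_mul_dist x k
    rw [hf k hk, sub_zero] at h2
    rw [lt_div_iff₀ (by positivity)] at hxk
    rw [sub_apply, hgf x (h2.trans (by nlinarith [dist_nonneg (x := x) (y := k)])), sub_self]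
  have h3 := hsmall g hgn hgη
  rw [map_sub, sub_eq_zero] at h1
  rw [← h1] at h3
  linarith [abs_pos.2 hne]

/-- Elements of `F(M)` supported on `K` lie in the closed span of the evaluations at `K`. -/
theorem mem_closure_span_of_supportedOn {φ : StrongDual ℝ (LipZero M p)}
    (hφ : φ ∈ lipschitzFree M p) {K : Set M} (h : SupportedOn K φ) :
    φ ∈ (Submodule.span ℝ (delta p '' K)).topologicalClosure := by
  by_contra hnot
  set V := (Submodule.span ℝ (delta p '' K)).topologicalClosure
  obtain ⟨Λ, u, hΛV, hΛφ⟩ := geometric_hahn_banach_closed_point (V.convex)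
    (Submodule.isClosed_topologicalClosure _) hnot
  have hu : 0 < u := by simpa using hΛV 0 V.zero_mem
  have hΛ0 : ∀ v ∈ V, Λ v = 0 := fun v hv => by
    by_contra hne
    have h1 := hΛV ((u / Λ v) • v) (V.smul_mem _ hv)
    rw [map_smul, smul_eq_mul, div_mul_cancel₀ _ hne] at h1
    exact h1.false
  -- On `F(M)`, the separating functional is evaluation at the Lipschitz function `x ↦ Λ (delta p
  -- x)`, which vanishes on `K` because `Λ` vanishes on `V`.
  obtain ⟨f, hf, -⟩ := exists_of_slope (p := p) (g := fun x => Λ (delta p x)) (norm_nonneg Λ)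
    (by
      have : delta p p = 0 := ContinuousLinearMap.ext fun f => f.apply_base
      rw [this, map_zero]) fun x y => by
    rw [← map_sub]
    refine (le_abs_self _).trans ((Λ.le_opNorm _).trans ?_)
    gcongr
    refine ContinuousLinearMap.opNorm_le_bound _ dist_nonneg fun g => ?_
    rw [mul_comm]
    exact g.abs_sub_le_norm_mul_dist x y
  have heq : lipschitzFree M p ≤ (Λ - ContinuousLinearMap.apply ℝ ℝ f).ker := by
    refine Submodule.topologicalClosure_minimal _ ?_ (ContinuousLinearMap.isClosed_ker _)
    rw [Submodule.span_le]
    rintro _ ⟨x, rfl⟩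
    exact sub_eq_zero.2 (hf x).symm
  have h1 : Λ φ = φ f := sub_eq_zero.1 (heq hφ)
  have h2 : φ f = 0 := h f fun x hx => by
    rw [hf]
    exact hΛ0 _ (Submodule.le_topologicalClosure _ (Submodule.subset_span ⟨x, hx, rfl⟩))
  linarith

/-- The isometric embedding of `F(K)` into the dual of `Lip₀(M)`. -/
theorem exists_isometry_lipschitzFree (K : Set M) (hp : p ∈ K) :
    ∃ ι : lipschitzFree K ⟨p, hp⟩ →ₗᵢ[ℝ] StrongDual ℝ (LipZero M p),
      ∀ φ ∈ (Submodule.span ℝ (delta p '' K)).topologicalClosure, ∃ ψ, ι ψ = φ := by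
  have hres : ∀ f : LipZero M p, ∃ g : LipZero K ⟨p, hp⟩, (∀ x : K, g x = f x) ∧ ‖g‖ ≤ ‖f‖ :=
    fun f => exists_of_slope (norm_nonneg f) f.apply_base fun x y => f.sub_le_norm_mul_dist x y
  choose R hR hRn using hres
  let T : LipZero M p →L[ℝ] LipZero K ⟨p, hp⟩ := LinearMap.mkContinuous
    { toFun := R
      map_add' := fun f g => ext fun x => by simp [hR]
      map_smul' := fun a f => ext fun x => by simp [hR] } 1 fun f => by
        rw [one_mul]; exact hRn f
  have hT : ∀ f (x : K), T f x = f x := hR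
  have hTle : ‖T‖ ≤ 1 := LinearMap.mkContinuous_norm_le _ zero_le_one _
  -- Norm-preserving (McShane) extension is what makes the adjoint of restriction isometric.
  have hext : ∀ g : LipZero K ⟨p, hp⟩, ∃ f : LipZero M p, T f = g ∧ ‖f‖ ≤ ‖g‖ := fun g => by
    classical
    have hg : LipschitzOnWith ‖g‖₊ (fun x => if h : x ∈ K then g ⟨x, h⟩ else 0) K := by
      refine LipschitzOnWith.of_dist_le_mul fun x hx y hy => ?_
      simp only [hx, hy, dif_pos]
      exact g.abs_sub_le_norm_mul_dist ⟨x, hx⟩ ⟨y, hy⟩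
    obtain ⟨e, he, hEq⟩ := hg.extend_real
    have heK : ∀ x : K, e x = g x := fun x => by rw [← hEq x.2]; simp
    obtain ⟨f, hf, hfn⟩ := exists_of_slope (p := p) (norm_nonneg g)
      ((heK ⟨p, hp⟩).trans g.apply_base)
      fun x y => (le_abs_self _).trans (he.dist_le_mul x y)
    exact ⟨f, ext fun x => by rw [hT, hf, heK], hfn⟩
  let A : StrongDual ℝ (LipZero K ⟨p, hp⟩) →L[ℝ] StrongDual ℝ (LipZero M p) :=
    ContinuousLinearMap.precomp ℝ T
  have hA : ∀ ψ, ‖A ψ‖ = ‖ψ‖ := fun ψ => by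
    refine le_antisymm ?_ (ContinuousLinearMap.opNorm_le_bound _ (norm_nonneg _) fun g => ?_)
    · exact (ψ.opNorm_comp_le T).trans (mul_le_of_le_one_right (norm_nonneg _) hTle)
    · obtain ⟨f, rfl, hf⟩ := hext g
      exact ((A ψ).le_opNorm f).trans (by gcongr)
  let ι : lipschitzFree K ⟨p, hp⟩ →ₗᵢ[ℝ] StrongDual ℝ (LipZero M p) :=
    ⟨A.toLinearMap ∘ₗ (lipschitzFree K ⟨p, hp⟩).subtype, fun ψ => hA ψ⟩
  have hcomplete : CompleteSpace (lipschitzFree K ⟨p, hp⟩) :=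
    isClosed_lipschitzFree.completeSpace_coe
  refine ⟨ι, fun φ hφ => ?_⟩
  have hle : (Submodule.span ℝ (delta p '' K)).topologicalClosure ≤ ι.toLinearMap.range := by
    refine Submodule.topologicalClosure_minimal _ ?_ ?_
    · rw [Submodule.span_le]
      rintro _ ⟨x, hx, rfl⟩
      exact ⟨⟨delta _ ⟨x, hx⟩, delta_mem_lipschitzFree _⟩,
        ContinuousLinearMap.ext fun f => hT f ⟨x, hx⟩⟩
    · exact ι.isometry.isClosedEmbedding.isClosed_range
  exact hle hφ

/-! ### Iterated compression to a compact set -/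

/-- An operator into `F(M)` from a space without complemented copies of `ℓ¹` is uniformly close to
an operator supported on a compact set. -/
theorem exists_compact_reduction [CompleteSpace M] {X : Type*} [NormedAddCommGroup X]
    [NormedSpace ℝ X] [CompleteSpace X]
    (hX : ¬ ContainsComplementedCopy (lp (fun _ : ℕ => ℝ) 1) X)
    (S : X →L[ℝ] StrongDual ℝ (LipZero M p)) (hS : ∀ x, S x ∈ lipschitzFree M p)
    {ε : ℝ} (hε : 0 < ε) :
    ∃ (K : Set M) (S' : X →L[ℝ] StrongDual ℝ (LipZero M p)), p ∈ K ∧ IsCompact K ∧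
      ‖S - S'‖ ≤ ε ∧ ∀ x, S' x ∈ lipschitzFree M p ∧ SupportedOn K (S' x) := by
  -- The factor `1 / 8` makes the weights `1 + dist e p` and `1 + dist x p` comparable when `x` lies
  -- in the part of `N n` around `e`. The errors `ε / 2 / 2 ^ n` add up to `ε`.
  let r : ℕ → ℝ := fun n => (1 / 2) ^ n / 8
  have hr : ∀ n, 0 < r n := fun n => by positivity
  have hr8 : ∀ n, r n ≤ 1 / 8 := fun n => by
    have : (1 / 2 : ℝ) ^ n ≤ 1 := pow_le_one₀ (by norm_num) (by norm_num)
    simp only [r]; linarith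
  choose next E hnext hE hpE hnorm hsupp using
    fun (n : ℕ) (T : {T : X →L[ℝ] StrongDual ℝ (LipZero M p) // ∀ x, T x ∈ lipschitzFree M p}) =>
      exists_compression hX T.1 T.2 (hr n) (show 0 < ε / 2 / 2 ^ n by positivity)
  let U : ℕ → {T : X →L[ℝ] StrongDual ℝ (LipZero M p) // ∀ x, T x ∈ lipschitzFree M p} :=
    fun n => Nat.rec ⟨S, hS⟩ (fun n T => ⟨next n T, hnext n T⟩) n
  let N : ℕ → Set M := fun n => nhd p (E n (U n)) (2 * r n)
  let C : ℕ → Set M := fun n => ⋂ i ≤ n, N i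
  have hpC : ∀ n, p ∈ C n := fun n => Set.mem_iInter₂.2 fun i _ =>
    subset_nhd _ (by linarith [hr i]) (hpE i (U i))
  have hCN : ∀ n, C n ⊆ N n := fun n x hx => Set.mem_iInter₂.1 hx n le_rfl
  have hanti : Antitone C := fun m n hmn => Set.biInter_subset_biInter_left fun i hi => le_trans hi hmn
  have hclosed : ∀ n, IsClosed (C n) := fun n =>
    isClosed_biInter fun i _ => isClosed_nhd (hE i (U i)) _
  have hUC : ∀ n x, SupportedOn (C n) ((U (n + 1)).1 x) := fun n => by
    induction n with
    | zero =>
      intro x f hf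
      refine hsupp 0 (U 0) Set.univ (fun y g hg => ?_) x f fun z hz => hf z ?_
      · have : g = 0 := ext fun z => hg z trivial
        rw [this, map_zero]
      · simpa [C] using hz.2
    | succ n ih =>
      intro x f hf
      refine hsupp (n + 1) (U (n + 1)) (C n) ih x f fun z hz => hf z ?_
      refine Set.mem_iInter₂.2 fun i hi => ?_
      rcases Nat.le_succ_iff.1 hi with h | rfl
      · exact Set.mem_iInter₂.1 hz.1 i h
      · exact hz.2
  have hdist : ∀ n, dist (U n).1 (U (n + 1)).1 ≤ ε / 2 / 2 ^ n := fun n =>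
    (dist_eq_norm (U n).1 (next n (U n))).trans_le (hnorm n (U n))
  obtain ⟨S', hS'⟩ := cauchySeq_tendsto_of_complete (cauchySeq_of_le_geometric_two hdist)
  have hpt : ∀ x, Filter.Tendsto (fun n => (U n).1 x) Filter.atTop (nhds (S' x)) := fun x =>
    ((ContinuousLinearMap.apply ℝ _ x).continuous.tendsto S').comp hS'
  have hmem : ∀ x, S' x ∈ lipschitzFree M p := fun x =>
    isClosed_lipschitzFree.mem_of_tendsto (hpt x) (Filter.Eventually.of_forall fun n => (U n).2 x)
  have hS'C : ∀ n x, SupportedOn (C n) (S' x) := fun n x f hf => by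
    have h1 : Filter.Tendsto (fun n => (U n).1 x f) Filter.atTop (nhds (S' x f)) :=
      ((ContinuousLinearMap.apply ℝ ℝ f).continuous.tendsto (S' x)).comp (hpt x)
    refine tendsto_nhds_unique h1 (tendsto_const_nhds.congr' ?_)
    filter_upwards [Filter.eventually_gt_atTop n] with m hm
    obtain ⟨k, rfl⟩ := Nat.exists_eq_add_of_lt hm
    exact (hUC (n + k) x f fun z hz => hf z (hanti (Nat.le_add_right _ _) hz)).symm
  have hclose : ∀ n, ∀ x ∈ N n, ∃ e ∈ E n (U n), dist x e ≤ 4 * r n * (1 + dist x p) := by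
    intro n x hx
    obtain ⟨e, he, hxe⟩ := mem_nhd.1 hx
    refine ⟨e, he, hxe.trans ?_⟩
    have h1 : dist e p ≤ dist x e + dist x p := by
      linarith [dist_triangle e x p, dist_comm e x]
    have h2 : 2 * r n * (1 + dist e p) ≤ 1 / 4 * (1 + dist e p) := by
      gcongr
      linarith [hr8 n]
    have h3 : 1 + dist e p ≤ 2 * (1 + dist x p) := by linarith [dist_nonneg (x := x) (y := p)]
    calc 2 * r n * (1 + dist e p) ≤ 2 * r n * (2 * (1 + dist x p)) := by
          gcongr
      _ = _ := by ring
  -- The first localisation is already bounded, so on all later sets the weighted radii are at most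
  -- a constant times `r n`.
  obtain ⟨R, hR⟩ : ∃ R, ∀ x ∈ N 0, dist x p ≤ R := by
    have : Bornology.IsBounded (N 0) :=
      (Bornology.isBounded_biUnion (hE 0 (U 0))).2 fun _ _ => Metric.isBounded_closedBall
    exact (Metric.isBounded_iff_subset_closedBall p).1 this
  have hR0 : 0 ≤ R := dist_nonneg.trans (hR p (hCN 0 (hpC 0)))
  obtain ⟨hK, hthick⟩ := isCompact_iInter_and_subset_thickening hclosed hanti fun η hη => by
    obtain ⟨n, hn⟩ := exists_pow_lt_of_lt_one (show 0 < η / (1 + R) by positivity)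
      (show (1 / 2 : ℝ) < 1 by norm_num)
    refine ⟨n, E n (U n), hE n (U n), fun x hx => ?_⟩
    obtain ⟨e, he, hxe⟩ := hclose n x (hCN n hx)
    refine Set.mem_iUnion₂.2 ⟨e, he, Metric.mem_ball.2 (hxe.trans_lt ?_)⟩
    have hxR := hR x (hCN 0 (hanti (Nat.zero_le n) hx))
    rw [lt_div_iff₀ (by positivity)] at hn
    calc 4 * r n * (1 + dist x p) ≤ (1 / 2) ^ n * (1 + R) := by
          have h8 : 4 * r n ≤ (1 / 2) ^ n := by
            simp only [r]
            linarith [show (0 : ℝ) < (1 / 2) ^ n by positivity]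
          gcongr
      _ < η := hn
  refine ⟨⋂ n, C n, S', Set.mem_iInter.2 hpC, hK, ?_, fun x => ⟨hmem x, ?_⟩⟩
  · exact (dist_eq_norm S S').ge.trans (dist_le_of_le_geometric_two_of_tendsto₀ hdist hS')
  · refine supportedOn_of_thickening (hmem x) fun η hη => ?_
    obtain ⟨n, hn⟩ := hthick η hη
    exact fun f hf => hS'C n x f fun z hz => hf z (hn hz)

end LipZero

/-! ### Isomorphic copies and the conclusion -/

theorem ContainsCopy.exists_le_norm {X Y : Type*} [NormedAddCommGroup X] [NormedSpace ℝ X]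
    [NormedAddCommGroup Y] [NormedSpace ℝ Y] (h : ContainsCopy X Y) :
    ∃ (J : X →L[ℝ] Y) (D : ℝ), 0 < D ∧ ∀ x, ‖x‖ ≤ D * ‖J x‖ := by
  obtain ⟨Z, ⟨e⟩⟩ := h
  refine ⟨Z.subtypeL.comp (e : X →L[ℝ] Z), ‖(e.symm : Z →L[ℝ] X)‖ + 1, by positivity, fun x => ?_⟩
  have h1 := (e.symm : Z →L[ℝ] X).le_opNorm (e x)
  rw [ContinuousLinearEquiv.coe_coe, e.symm_apply_apply] at h1
  refine h1.trans ?_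
  change _ ≤ _ * ‖e x‖
  gcongr
  linarith

/-- A bounded below operator from a Banach space is an isomorphism onto its range. -/
theorem containsCopy_of_le_norm {X Y : Type*} [NormedAddCommGroup X] [NormedSpace ℝ X]
    [NormedAddCommGroup Y] [NormedSpace ℝ Y] (T : X →ₗ[ℝ] Y) {c C : ℝ} (hc : 0 < c)
    (hlow : ∀ x, c * ‖x‖ ≤ ‖T x‖) (hup : ∀ x, ‖T x‖ ≤ C * ‖x‖) : ContainsCopy X Y := by
  have hinj : Function.Injective T := (injective_iff_map_eq_zero T).2 fun x hx => by
    have h1 := hlow x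
    rw [hx, norm_zero] at h1
    exact norm_le_zero_iff.1 (nonpos_of_mul_nonpos_right h1 hc)
  refine ⟨T.range, ⟨(LinearEquiv.ofInjective T hinj).toContinuousLinearEquivOfBounds C c⁻¹ hup
    fun y => ?_⟩⟩
  obtain ⟨x, rfl⟩ := (LinearEquiv.ofInjective T hinj).surjective y
  rw [LinearEquiv.symm_apply_apply, le_inv_mul_iff₀ hc]
  exact hlow x

theorem corollary2p8 {M : Type*} [MetricSpace M] [CompleteSpace M] (p : M)
    {X : Type*} [NormedAddCommGroup X] [NormedSpace ℝ X] [CompleteSpace X]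
    (hX : ¬ ContainsComplementedCopy (lp (fun _ : ℕ => ℝ) 1) X)
    (hM : ContainsCopy X (lipschitzFree M p)) :
    ∃ (K : Set M) (hp : p ∈ K), IsCompact K ∧ ContainsCopy X (lipschitzFree K ⟨p, hp⟩) := by
  obtain ⟨J, D, hD, he⟩ := hM.exists_le_norm
  let S : X →L[ℝ] StrongDual ℝ (LipZero M p) := (lipschitzFree M p).subtypeL.comp J
  replace he : ∀ x, ‖x‖ ≤ D * ‖S x‖ := he
  -- The allowed error is half of the lower bound `D⁻¹` of `S`, so the other half remains for `S'`.
  obtain ⟨K, S', hp, hK, hSS', hS'⟩ := LipZero.exists_compact_reduction hX S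
    (fun x => (J x).2) (show 0 < (2 * D)⁻¹ by positivity)
  obtain ⟨ι, hι⟩ := LipZero.exists_isometry_lipschitzFree K hp
  choose T hT using fun x => hι (S' x)
    (LipZero.mem_closure_span_of_supportedOn (hS' x).1 (hS' x).2)
  have hTn : ∀ x, ‖T x‖ = ‖S' x‖ := fun x => by rw [← hT, ι.norm_map]
  refine ⟨K, hp, hK, containsCopy_of_le_norm
    { toFun := T
      map_add' := fun x y => ι.injective (by rw [map_add, hT, hT, hT, map_add])
      map_smul' := fun a x => ι.injective (by rw [RingHom.id_apply, map_smul, hT, hT, map_smul]) }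
    (show 0 < (2 * D)⁻¹ by positivity) (C := ‖S'‖) (fun x => ?_) fun x => ?_⟩
  · change _ ≤ ‖T x‖
    rw [hTn]
    have h1 : ‖S x - S' x‖ ≤ (2 * D)⁻¹ * ‖x‖ := ((S - S').le_opNorm x).trans (by gcongr)
    have h2 : ‖S x‖ ≤ ‖S x - S' x‖ + ‖S' x‖ := by
      simpa using norm_add_le (S x - S' x) (S' x)
    have h3 : D⁻¹ * ‖x‖ ≤ ‖S x‖ := (inv_mul_le_iff₀ hD).2 (he x)
    have h4 : D⁻¹ = (2 * D)⁻¹ + (2 * D)⁻¹ := by field_simp; norm_num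
    rw [h4, add_mul] at h3
    linarith
  · change ‖T x‖ ≤ _
    rw [hTn]
    exact S'.le_opNorm x
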